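/- Let $\Omega$ be a finite set of states and let $\mathbb D\Omega\subseteq\mathbb R^\Omega$ be the set of probability distributions on $\Omega$, with $\delta_s$ the point distribution at $s$. Let $\mathbb H_1\Omega$ be the set of maps $r$ sending each $s\in\Omega$ to a nonempty, closed, convex set $r(s)\subseteq\mathbb D\Omega$; write $r\sqsubseteq_{\mathbb H}r'$ if $r(s)\subseteq r'(s)$ for all $s$, and $\delta$ for the map $s\mapsto\{\delta_s\}$. A test is a map $b$ with $b(s)\subseteq\{\delta_s\}$ for all $s$; $\sqsubseteq_{\mathbb H}$ is extended to tests. A bundle event structure with internal probability (ipBES) is $\mathcal E=(E,\mapsto,\#,\lambda,\Phi)$, where $\#$ is an irreflexive symmetric relation on the set $E$ of events, $\mapsto\ \subseteq\mathcal P(E)\times E$, each $\lambda(e)$ is an element of $\mathbb H_1\Omega$ or a test, $\Phi\subseteq\mathcal P(E)$, and any two different elements of $x$ are in conflict whenever $x\in\Phi$ or $x\mapsto e$ for some $e$. A (finite) trace is a finite sequence $e_1\cdots e_n$ of pairwise different, pairwise non-conflicting events such that whenever $x\mapsto e_j$ there is $i<j$ with $e_i\in x$. Write $\mathcal T(\mathcal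 E)$ for the set of traces and $\mathcal T_{\max}(\mathcal E)$ for the set of traces that are maximal in the prefix order. $\mathcal E$ is non-zero if it has a nonempty trace, and feasible if for every non-maximal trace $\alpha$ and every state $s$ there is an event $e$ with $\alpha e\in\mathcal T(\mathcal E)$ and $\lambda(e)(s)\ne\emptyset$. A scheduler $\sigma$ on $\mathcal E$ assigns to each trace $\alpha$ a partial function $\sigma(\alpha)$ from $E\times\Omega$ to subdistributions on $\Omega$, with domain $\{(e,s):\alpha e\in\mathcal T(\mathcal E)\}$, such that for each $\alpha$ there is $w:E\times\Omega\to[0,1]$ satisfying, for all $(e,s)$ in the domain: if $\lambda(e)(s)\neq\emptyset$ then $\sigma(\alpha)(e,s)=w(e,s)\mu$ for some $\mu\in\lambda(e)(s)$; if $\lambda(e)(s)=\emptyset$ then $w(e,s)=0$ and $\sigma(\alpha)(e,s)=0$; and, if $\alpha$ is not maximal, $\sum_{e:\,\alpha e\in\mathcal T(\mathcal E)}w(e,s)=1$ for every $s$. From an initial state $s$ put $\varphi(\emptyset)=\delta_s$, $\varphi(\alpha e)(u)=\sum_{t\in\Omega}\sigma(\alpha)(e,t)(u)\,\varphi(\alpha)(t)$,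 and $\sigma_s(\mathcal E)=\sum_{\alpha\in\mathcal T_{\max}(\mathcal E)}\varphi(\alpha)$. Let $\mathbf{Sched}_1(\mathcal E)$ be the set of schedulers $\sigma$ such that $\sigma_s(\mathcal E)$ is a distribution for every $s\in\Omega$. Call $\mathcal E$ terminating if $\mathbf{Sched}_1(\mathcal E)\neq\emptyset$, and define $$[\![\mathcal E]\!](s)=\overline{\mathrm{conv}\{\sigma_s(\mathcal E):\sigma\in\mathbf{Sched}_1(\mathcal E)\}}.$$ A trace $\alpha$ is weakly maximal if there are $n\ge 0$ events $e_1,\dots,e_n$ with $\alpha e_1\cdots e_n$ a maximal trace and $\delta\sqsubseteq_{\mathbb H}\lambda(e_i)$ for all $i$. A t-simulation from $\mathcal E$ to $\mathcal F$ is a function $f:\mathcal T(\mathcal E)\to\mathcal T(\mathcal F)$ such that - $f(\emptyset)=\emptyset$ and $f^{-1}(\beta)$ is finite for every $\beta\in\mathcal T(\mathcal F)$; - if $\alpha e\in\mathcal T(\mathcal E)$, then either $f(\alpha e)=f(\alpha)$ and $\lambda(e)\sqsubseteq_{\mathbb H}\delta$, or $f(\alpha e)=f(\alpha)e'$ for some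 event $e'$ of $\mathcal F$ with $\lambda(e)\sqsubseteq_{\mathbb H}\lambda(e')$; - if $\alpha e\in\mathcal T_{\max}(\mathcal E)$, then $f(\alpha e)=f(\alpha)e'$ for some event $e'$ of $\mathcal F$ with $\lambda(e)\sqsubseteq_{\mathbb H}\lambda(e')$, and $f(\alpha e)$ is weakly maximal in $\mathcal T(\mathcal F)$. Write $\mathcal E\sqsubseteq_{\mathrm{sim}}\mathcal F$ if such an $f$ exists. **Theorem.** Let $\mathcal E$ and $\mathcal F$ be feasible and terminating ipBES over $\Omega$, with $\mathcal E$ non-zero. If $\mathcal E\sqsubseteq_{\mathrm{sim}}\mathcal F$, then $\mathcal E$ sequentially refines $\mathcal F$, that is, $[\![\mathcal E]\!]$ and $[\![\mathcal F]\!]$ belong to $\mathbb H_1\Omega$ and $[\![\mathcal E]\!](s)\subseteq[\![\mathcal F]\!](s)$ for every $s\in\Omega$. -/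

import Mathlib

noncomputable section

/-! ### Sequential probabilistic programs over a finite state space

A program is a map `Ω → Set (Ω → ℝ)`; distributions are the points of `stdSimplex ℝ Ω`. -/

/-- The point distribution `δ_s`. -/
def pointDist {Ω : Type*} (s : Ω) : Ω → ℝ :=
  open Classical in fun t => if t = s then 1 else 0

/-- The ineffectual program `δ`, with `δ(s) = {δ_s}`. -/
def skipProg {Ω : Type*} (s : Ω) : Set (Ω → ℝ) := {pointDist s}

/-- Membership in `ℍ₁Ω`: every value is a nonempty, topologically closed and convex set of
distributions. -/
structure IsProgram {Ω : Type*} [Fintype Ω] (r : Ω → Set (Ω → ℝ)) : Prop where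
  subset_dist : ∀ s, r s ⊆ stdSimplex ℝ Ω
  nonempty : ∀ s, (r s).Nonempty
  isClosed : ∀ s, IsClosed (r s)
  convex : ∀ s, Convex ℝ (r s)

/-- Tests: `b(s) ⊆ {δ_s}` for every state `s`. -/
def IsTest {Ω : Type*} (b : Ω → Set (Ω → ℝ)) : Prop := ∀ s, b s ⊆ {pointDist s}

/-- The refinement order `⊑_ℍ`: pointwise inclusion. -/
def ProgRefines {Ω : Type*} (r r' : Ω → Set (Ω → ℝ)) : Prop := ∀ s, r s ⊆ r' s

/-! ### Bundle event structures with internal probability -/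

/-- A bundle event structure with internal probability (ipBES) on the set of events `E`, over the
finite state space `Ω`. The condition `x # x` says that any two different elements of `x` are in
conflict. -/
structure IPBES (Ω : Type*) [Fintype Ω] (E : Type*) where
  /-- the conflict relation `#` -/
  conflict : E → E → Prop
  conflict_irrefl : ∀ e, ¬ conflict e e
  conflict_symm : ∀ e e', conflict e e' → conflict e' e
  /-- the bundle relation `x ↦ e` -/
  bundle : Set E → E → Prop
  bundle_conflict : ∀ x e, bundle x e → x.Pairwise conflict
  /-- the labels `λ(e)` -/
  label : E → Ω → Set (Ω → ℝ)
  label_mem : ∀ e, IsProgram (label e) ∨ IsTest (label e)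
  /-- the set `Φ` of sets of final events -/
  final : Set (Set E)
  final_conflict : ∀ x ∈ final, x.Pairwise conflict

namespace IPBES

variable {Ω : Type*} [Fintype Ω] {E F : Type*}

/-- Finite traces `e₁ e₂ ⋯ eₙ`: the events are pairwise different and pairwise not in conflict, and
every event is enabled when it occurs, i.e. if `x ↦ e_j` then `e_i ∈ x` for some `i < j`. -/
structure IsTrace (S : IPBES Ω E) (α : List E) : Prop where
  nodup : α.Nodup
  conflict_free : ∀ e ∈ α, ∀ e' ∈ α, ¬ S.conflict e e'
  enabled : ∀ (β : List E) (e : E), β ++ [e] <+: α → ∀ x, S.bundle x e → ∃ e' ∈ β, e' ∈ x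

/-- The type `𝒯(S)` of finite traces. -/
def Trace (S : IPBES Ω E) : Type _ := {α : List E // S.IsTrace α}

/-- Maximal traces, with respect to the prefix order on finite traces. -/
def IsMaxTrace (S : IPBES Ω E) (α : List E) : Prop :=
  S.IsTrace α ∧ ∀ β, S.IsTrace β → α <+: β → β = α

/-- `S` is non-zero: some event can occur initially, i.e. there is a nonempty trace. -/
def NonZero (S : IPBES Ω E) : Prop := ∃ e, S.IsTrace [e]

/-- Feasibility: at every non-maximal trace `α` and state `s`, some event `e` that can extend `α`
has `λ(e)(s) ≠ ∅`. -/
def Feasible (S : IPBES Ω E) : Prop :=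
  ∀ α, S.IsTrace α → ¬ S.IsMaxTrace α →
    (⋃ e ∈ {e | S.IsTrace (α ++ [e])}, {s | (S.label e s).Nonempty}) = Set.univ

/-! ### Schedulers -/

/-- Schedulers on `S`. For a trace `α`, the partial function `σ(α)` on `E × Ω`, with domain
`{(e, s) | α e ∈ 𝒯}`, is represented by its extension by `0`. The function `w` is the weight function
of `σ` at `α`. -/
structure IsScheduler (S : IPBES Ω E) (σ : List E → E → Ω → (Ω → ℝ)) : Prop where
  off_dom : ∀ α e s, ¬ S.IsTrace (α ++ [e]) → σ α e s = 0
  weights : ∀ α, S.IsTrace α → ∃ w : E → Ω → ℝ,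
    (∀ e s, w e s ∈ Set.Icc (0 : ℝ) 1) ∧
    (∀ e s, S.IsTrace (α ++ [e]) → (S.label e s).Nonempty →
      ∃ μ ∈ S.label e s, σ α e s = w e s • μ) ∧
    (¬ S.IsMaxTrace α → ∀ s, HasSum (fun e : {e // S.IsTrace (α ++ [e])} => w e s) 1) ∧
    (∀ e s, S.IsTrace (α ++ [e]) → S.label e s = ∅ → w e s = 0 ∧ σ α e s = 0)

/-- Auxiliary recursion for `run`, on the reversed list of events. -/
def runRev (σ : List E → E → Ω → (Ω → ℝ)) (s : Ω) : List E → (Ω → ℝ)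
  | [] => pointDist s
  | e :: l => fun u => ∑ t, σ l.reverse e t u * runRev σ s l t

/-- The complete run `φ` of the scheduler `σ` from the initial state `s`; it is determined by the two
equations `run_nil` and `run_concat` below. -/
def run (σ : List E → E → Ω → (Ω → ℝ)) (s : Ω) (α : List E) : Ω → ℝ :=
  runRev σ s α.reverse

theorem run_nil (σ : List E → E → Ω → (Ω → ℝ)) (s : Ω) : run σ s [] = pointDist s := rfl

theorem run_concat (σ : List E → E → Ω → (Ω → ℝ)) (s : Ω) (α : List E) (e : E) (u : Ω) :
    run σ s (α ++ [e]) u = ∑ t, σ α e t u * run σ s α t := by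
  simp [run, runRev]

/-- The sequential behaviour `σ_s(S) = ∑_{α maximal} φ(α)`. For a scheduler `σ` the terms are
nonnegative and all partial sums are at most `1`, so the series converges. -/
def behaviour (S : IPBES Ω E) (σ : List E → E → Ω → (Ω → ℝ)) (s : Ω) : Ω → ℝ :=
  fun u => ∑' α : {α : List E // S.IsMaxTrace α}, run σ s α.1 u

/-- The set `Sched₁(S)` of schedulers that terminate almost surely from every initial state. -/
def Sched₁ (S : IPBES Ω E) : Set (List E → E → Ω → (Ω → ℝ)) :=
  {σ | S.IsScheduler σ ∧ ∀ s, S.behaviour σ s ∈ stdSimplex ℝ Ω}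

/-- `S` is terminating: it has a scheduler that terminates almost surely. -/
def Terminating (S : IPBES Ω E) : Prop := S.Sched₁.Nonempty

/-- The semantics `⟦S⟧(s)`: the closed convex hull of the sequential behaviours `σ_s(S)`. -/
def sem (S : IPBES Ω E) (s : Ω) : Set (Ω → ℝ) :=
  closure (convexHull ℝ {μ | ∃ σ ∈ S.Sched₁, μ = S.behaviour σ s})

/-- Sequential refinement `S ⊑ T`. -/
def SeqRefines (S : IPBES Ω E) (T : IPBES Ω F) : Prop := ProgRefines S.sem T.sem

/-! ### Simulation -/

/-- Weakly maximal traces: extendable to a maximal trace by finitely many (possibly zero) events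
whose labels are refined by `δ`. -/
def IsWeaklyMaxTrace (S : IPBES Ω E) (α : List E) : Prop :=
  S.IsTrace α ∧ ∃ l : List E, S.IsMaxTrace (α ++ l) ∧ ∀ e ∈ l, ProgRefines skipProg (S.label e)

/-- t-simulations `f : 𝒯(S) → 𝒯(T)`. In `step` and `max`, the trace `α'` is `α e`. -/
structure IsTSimulation (S : IPBES Ω E) (T : IPBES Ω F) (f : S.Trace → T.Trace) : Prop where
  nil : ∀ α : S.Trace, α.1 = [] → (f α).1 = []
  finite_fibers : ∀ β : T.Trace, (f ⁻¹' {β}).Finite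
  step : ∀ (α α' : S.Trace) (e : E), α'.1 = α.1 ++ [e] →
    (f α' = f α ∧ ProgRefines (S.label e) skipProg) ∨
    ∃ e' : F, ProgRefines (S.label e) (T.label e') ∧ (f α').1 = (f α).1 ++ [e']
  max : ∀ (α α' : S.Trace) (e : E), α'.1 = α.1 ++ [e] → S.IsMaxTrace α'.1 →
    (∃ e' : F, ProgRefines (S.label e) (T.label e') ∧ (f α').1 = (f α).1 ++ [e']) ∧
    T.IsWeaklyMaxTrace (f α').1

/-- `S` is simulated by `T`. -/
def SimulatedBy (S : IPBES Ω E) (T : IPBES Ω F) : Prop :=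
  ∃ f : S.Trace → T.Trace, S.IsTSimulation T f

end IPBES

end

open Finset
open scoped Pointwise

/-! ### Scaled elements of convex sets. -/

/-- `x` is a nonnegative multiple `c • μ` of an element `μ` of `C`, or `c` and `x` both vanish. -/
def ScaledMem {Ω : Type*} (C : Set (Ω → ℝ)) (c : ℝ) (x : Ω → ℝ) : Prop :=
  (c = 0 ∧ x = 0) ∨ (0 < c ∧ ∃ μ ∈ C, x = c • μ)

namespace ScaledMem

variable {Ω : Type*} {C D : Set (Ω → ℝ)} {c d : ℝ} {x y : Ω → ℝ}

theorem zero : ScaledMem C 0 0 := Or.inl ⟨rfl, rfl⟩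

theorem nonneg (h : ScaledMem C c x) : 0 ≤ c := by
  rcases h with h | h
  exacts [h.1.ge, h.1.le]

theorem eq_zero (h : ScaledMem C c x) (hc : c = 0) : x = 0 := by
  rcases h with h | h
  exacts [h.2, absurd hc h.1.ne']

theorem mono (h : ScaledMem C c x) (hCD : C ⊆ D) : ScaledMem D c x :=
  h.imp_right fun ⟨hc, μ, hμ, hx⟩ => ⟨hc, μ, hCD hμ, hx⟩

theorem of_mem {μ : Ω → ℝ} (hμ : μ ∈ C) (hc : 0 ≤ c) : ScaledMem C c (c • μ) := by
  rcases hc.eq_or_lt with rfl | hc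
  · exact Or.inl ⟨rfl, zero_smul _ _⟩
  · exact Or.inr ⟨hc, μ, hμ, rfl⟩

theorem smul (h : ScaledMem C c x) (hd : 0 ≤ d) : ScaledMem C (d * c) (d • x) := by
  rcases h with ⟨rfl, rfl⟩ | ⟨hc, μ, hμ, rfl⟩
  · simpa using zero
  · rw [smul_smul]
    exact of_mem hμ (mul_nonneg hd hc.le)

/-- For convex `C` and positive scalars, `c • C + d • C = (c + d) • C`. -/
theorem add (hC : Convex ℝ C) (h : ScaledMem C c x) (h' : ScaledMem C d y) :
    ScaledMem C (c + d) (x + y) := by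
  rcases h with ⟨rfl, rfl⟩ | ⟨hc, μ, hμ, rfl⟩
  · simpa using h'
  rcases h' with ⟨rfl, rfl⟩ | ⟨hd, ν, hν, rfl⟩
  · simpa using of_mem hμ hc.le
  obtain ⟨ξ, hξ, hx⟩ : c • μ + d • ν ∈ (c + d) • C := by
    rw [hC.add_smul hc.le hd.le]
    exact Set.add_mem_add (Set.smul_mem_smul_set hμ) (Set.smul_mem_smul_set hν)
  exact hx ▸ of_mem hξ (add_pos hc hd).le

theorem sum {ι : Type*} (hC : Convex ℝ C) {s : Finset ι} {c : ι → ℝ} {x : ι → Ω → ℝ}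
    (h : ∀ i ∈ s, ScaledMem C (c i) (x i)) : ScaledMem C (∑ i ∈ s, c i) (∑ i ∈ s, x i) := by
  classical
  induction s using Finset.induction_on with
  | empty => simpa using zero
  | insert a s ha ih =>
    rw [sum_insert ha, sum_insert ha]
    exact add hC (h a (mem_insert_self a s)) (ih fun i hi => h i (mem_insert_of_mem hi))

theorem apply_nonneg [Fintype Ω] (h : ScaledMem C c x) (hC : C ⊆ stdSimplex ℝ Ω) (u : Ω) :
    0 ≤ x u := by
  rcases h with ⟨rfl, rfl⟩ | ⟨hc, μ, hμ, rfl⟩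
  · exact le_rfl
  · exact mul_nonneg hc.le ((hC hμ).1 u)

theorem sum_apply [Fintype Ω] (h : ScaledMem C c x) (hC : C ⊆ stdSimplex ℝ Ω) :
    ∑ u, x u = c := by
  rcases h with ⟨rfl, rfl⟩ | ⟨hc, μ, hμ, rfl⟩
  · simp
  · simp [← mul_sum, (hC hμ).2]

end ScaledMem

theorem pointDist_mem_stdSimplex {Ω : Type*} [Fintype Ω] (s : Ω) :
    pointDist s ∈ stdSimplex ℝ Ω := by
  classical
  refine ⟨fun t => ?_, ?_⟩
  · unfold pointDist
    split_ifs <;> norm_num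
  · simp [pointDist]

namespace IPBES

variable {Ω : Type*} [Fintype Ω] {E F : Type*} {S : IPBES Ω E} {T : IPBES Ω F}

/-! ### Labels and traces. -/

theorem label_subset_stdSimplex (S : IPBES Ω E) (e : E) (s : Ω) :
    S.label e s ⊆ stdSimplex ℝ Ω := by
  rcases S.label_mem e with h | h
  · exact h.subset_dist s
  · exact (h s).trans (Set.singleton_subset_iff.2 (pointDist_mem_stdSimplex s))

theorem convex_label (S : IPBES Ω E) (e : E) (s : Ω) : Convex ℝ (S.label e s) := by
  rcases S.label_mem e with h | h
  · exact h.convex s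
  · exact (Set.subsingleton_singleton.anti (h s)).convex

theorem IsTrace.of_prefix {α β : List E} (h : S.IsTrace β) (hp : α <+: β) : S.IsTrace α where
  nodup := h.nodup.sublist hp.sublist
  conflict_free e he e' he' := h.conflict_free e (hp.subset he) e' (hp.subset he')
  enabled γ e hγ := h.enabled γ e (hγ.trans hp)

theorem IsTrace.of_concat {α : List E} {e : E} (h : S.IsTrace (α ++ [e])) : S.IsTrace α :=
  h.of_prefix (List.prefix_append _ _)

theorem isTrace_nil (S : IPBES Ω E) : S.IsTrace [] where
  nodup := List.nodup_nil
  conflict_free := by simp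
  enabled β e h := by simp at h

theorem IsMaxTrace.not_isTrace_concat {α : List E} (h : S.IsMaxTrace α) (e : E) :
    ¬ S.IsTrace (α ++ [e]) := fun h' => by
  simpa using h.2 _ h' (List.prefix_append _ _)

theorem IsTrace.not_isMaxTrace {α : List E} {e : E} (h : S.IsTrace (α ++ [e])) :
    ¬ S.IsMaxTrace α := fun h' => h'.not_isTrace_concat e h

/-! ### Weight functions, and the bound on the mass of a behaviour. -/

/-- `w` is a family of weight functions witnessing that `σ` is a scheduler, extended by zero. -/
structure IsWeight (S : IPBES Ω E) (σ : List E → E → Ω → (Ω → ℝ)) (w : List E → E → Ω → ℝ) :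
    Prop where
  scaledMem : ∀ α e s, S.IsTrace (α ++ [e]) → ScaledMem (S.label e s) (w α e s) (σ α e s)
  off_dom : ∀ α e s, ¬ S.IsTrace (α ++ [e]) → w α e s = 0 ∧ σ α e s = 0
  hasSum : ∀ α, S.IsTrace α → ¬ S.IsMaxTrace α → ∀ s, HasSum (fun e => w α e s) 1

theorem IsScheduler.exists_isWeight {σ : List E → E → Ω → (Ω → ℝ)} (h : S.IsScheduler σ) :
    ∃ w, S.IsWeight σ w := by
  classical
  choose w hw using h.weights
  refine ⟨fun α e s => if he : S.IsTrace (α ++ [e]) then w α he.of_concat e s else 0, ?_, ?_, ?_⟩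
  · intro α e s he
    obtain ⟨h01, hne, -, hemp⟩ := hw α he.of_concat
    simp only [dif_pos he]
    rcases (S.label e s).eq_empty_or_nonempty with h0 | h0
    · exact Or.inl (hemp e s he h0)
    · obtain ⟨μ, hμ, hx⟩ := hne e s he h0
      exact hx ▸ ScaledMem.of_mem hμ (h01 e s).1
  · intro α e s he
    exact ⟨by simp [he], h.off_dom α e s he⟩
  · intro α hα hm s
    have := (hw α hα).2.2.1 hm s
    rw [← (Subtype.val_injective (p := fun e => S.IsTrace (α ++ [e]))).hasSum_iff]
    · convert this using 2 with e
      simp [e.2]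
    · intro e he
      have : ¬ S.IsTrace (α ++ [e]) := by simpa using he
      simp [this]

namespace IsWeight

variable {σ : List E → E → Ω → (Ω → ℝ)} {w : List E → E → Ω → ℝ}

theorem nonneg (h : S.IsWeight σ w) (α : List E) (e : E) (s : Ω) : 0 ≤ w α e s := by
  by_cases he : S.IsTrace (α ++ [e])
  · exact (h.scaledMem α e s he).nonneg
  · exact (h.off_dom α e s he).1.ge

theorem apply_nonneg (h : S.IsWeight σ w) (α : List E) (e : E) (s u : Ω) : 0 ≤ σ α e s u := by
  by_cases he : S.IsTrace (α ++ [e])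
  · exact (h.scaledMem α e s he).apply_nonneg (S.label_subset_stdSimplex e s) u
  · simp [(h.off_dom α e s he).2]

theorem sum_apply (h : S.IsWeight σ w) (α : List E) (e : E) (s : Ω) :
    ∑ u, σ α e s u = w α e s := by
  by_cases he : S.IsTrace (α ++ [e])
  · exact (h.scaledMem α e s he).sum_apply (S.label_subset_stdSimplex e s)
  · simp [h.off_dom α e s he]

theorem isScheduler (h : S.IsWeight σ w) : S.IsScheduler σ where
  off_dom α e s he := (h.off_dom α e s he).2
  weights α hα := by
    refine ⟨w α, fun e s => ⟨h.nonneg α e s, ?_⟩, fun e s he hne => ?_, fun hm s => ?_,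
      fun e s he hemp => ?_⟩
    · by_cases he : S.IsTrace (α ++ [e])
      -- A nonnegative term of a family summing to one is at most one.
      · exact le_hasSum (h.hasSum α hα he.not_isMaxTrace s) e fun e' _ => h.nonneg α e' s
      · simp [(h.off_dom α e s he).1]
    · rcases h.scaledMem α e s he with ⟨hw, hx⟩ | ⟨-, hx⟩
      · obtain ⟨μ, hμ⟩ := hne
        exact ⟨μ, hμ, by simp [hw, hx]⟩
      · exact hx
    · refine ((Subtype.val_injective (p := fun e => S.IsTrace (α ++ [e]))).hasSum_iff ?_).2
        (h.hasSum α hα hm s)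
      intro e he
      exact (h.off_dom α e s (by simpa using he)).1
    · rcases h.scaledMem α e s he with hw | ⟨-, μ, hμ, -⟩
      · exact hw
      · simp [hemp] at hμ

theorem run_nonneg (h : S.IsWeight σ w) (s : Ω) (α : List E) (u : Ω) : 0 ≤ run σ s α u := by
  induction α using List.reverseRecOn generalizing u with
  | nil => exact (pointDist_mem_stdSimplex s).1 u
  | append_singleton α e ih =>
    rw [run_concat]
    exact sum_nonneg fun t _ => mul_nonneg (h.apply_nonneg α e t u) (ih t)

theorem sum_run_concat (h : S.IsWeight σ w) (s : Ω) (α : List E) (e : E) :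
    ∑ u, run σ s (α ++ [e]) u = ∑ t, w α e t * run σ s α t := by
  simp_rw [run_concat]
  rw [sum_comm]
  simp_rw [← sum_mul, h.sum_apply]

theorem eq_zero_of_not_extendable (h : S.IsWeight σ w) {α : List E}
    (hα : ¬ (S.IsTrace α ∧ ¬ S.IsMaxTrace α)) (e : E) (s : Ω) : w α e s = 0 :=
  (h.off_dom α e s fun he => hα ⟨he.of_concat, he.not_isMaxTrace⟩).1

/-- One step preserves mass at a non-maximal trace, since the weights sum to one in each state;
elsewhere nothing flows on. Working in `ENNReal` avoids summability side conditions. -/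
theorem tsum_ofReal_sum_run_concat_le (h : S.IsWeight σ w) (s : Ω) (α : List E) :
    ∑' e, ENNReal.ofReal (∑ u, run σ s (α ++ [e]) u) ≤
      open Classical in
      if S.IsMaxTrace α then 0 else ENNReal.ofReal (∑ u, run σ s α u) := by
  classical
  by_cases hα : S.IsTrace α ∧ ¬ S.IsMaxTrace α
  · rw [if_neg hα.2]
    have key : ∀ e, ENNReal.ofReal (∑ u, run σ s (α ++ [e]) u) =
        ∑ t, ENNReal.ofReal (w α e t) * ENNReal.ofReal (run σ s α t) := fun e => by
      rw [h.sum_run_concat, ENNReal.ofReal_sum_of_nonneg fun t _ =>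
        mul_nonneg (h.nonneg α e t) (h.run_nonneg s α t)]
      exact sum_congr rfl fun t _ => ENNReal.ofReal_mul (h.nonneg α e t)
    simp_rw [key]
    rw [Summable.tsum_finsetSum fun _ _ => ENNReal.summable,
      ENNReal.ofReal_sum_of_nonneg fun t _ => h.run_nonneg s α t]
    refine sum_le_sum fun t _ => ?_
    have hs := h.hasSum α hα.1 hα.2 t
    rw [ENNReal.tsum_mul_right, ← ENNReal.ofReal_tsum_of_nonneg (fun e => h.nonneg α e t)
      hs.summable, hs.tsum_eq]
    simp
  · have key : ∀ e, ENNReal.ofReal (∑ u, run σ s (α ++ [e]) u) = 0 := fun e => by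
      rw [h.sum_run_concat]
      simp [h.eq_zero_of_not_extendable hα]
    simp [key]

/-- Count by length: the mass at length `n` covers both the mass at length `n + 1` and the mass
stopping at maximal traces of length `n`. Telescoping from total mass one bounds all stopped mass.
-/
theorem tsum_isMaxTrace_le_one (h : S.IsWeight σ w) (s : Ω) :
    ∑' α : {α // S.IsMaxTrace α}, ENNReal.ofReal (∑ u, run σ s α.1 u) ≤ 1 := by
  classical
  set R : List E → ENNReal := fun α => ENNReal.ofReal (∑ u, run σ s α u) with hR
  set lev : ℕ → ENNReal := fun n => ∑' α : List E, if α.length = n then R α else 0 with hlev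
  set out : ℕ → ENNReal := fun n =>
    ∑' α : List E, if α.length = n then (if S.IsMaxTrace α then R α else 0) else 0 with hout
  have step : ∀ n, lev (n + 1) + out n ≤ lev n := fun n => by
    have inj : Function.Injective fun p : List E × E => p.1 ++ [p.2] := by
      rintro ⟨a, e⟩ ⟨b, e'⟩ hab
      simpa using hab
    have e1 : lev (n + 1) = ∑' α : List E, ∑' e, if α.length = n then R (α ++ [e]) else 0 := by
      rw [← ENNReal.tsum_prod (f := fun (α : List E) (e : E) =>
        if α.length = n then R (α ++ [e]) else 0)]
      simp only [hlev]
      rw [← inj.tsum_eq]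
      · simp
      · intro α hα
        rcases α.eq_nil_or_concat with rfl | ⟨a, e, rfl⟩
        · simp at hα
        · exact ⟨(a, e), by simp⟩
    rw [e1, ← ENNReal.tsum_add]
    refine ENNReal.tsum_le_tsum fun α => ?_
    by_cases hn : α.length = n
    · simp only [hn, if_true]
      have := h.tsum_ofReal_sum_run_concat_le s α
      refine (add_le_add_left this _).trans ?_
      by_cases hm : S.IsMaxTrace α <;> simp [hm, hR]
    · simp [hn]
  have lev0 : lev 0 = 1 := by
    rw [hlev]
    simp only [List.length_eq_zero_iff]
    rw [tsum_ite_eq]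
    simp [hR, run_nil, (pointDist_mem_stdSimplex s).2]
  have bound : ∀ n, lev n + ∑ k ∈ range n, out k ≤ 1 := fun n => by
    induction n with
    | zero => simp [lev0]
    | succ n ih =>
      rw [sum_range_succ, add_comm (∑ k ∈ range n, out k), ← add_assoc]
      exact (add_le_add_left (step n) _).trans ih
  have total : ∑' α : {α // S.IsMaxTrace α}, R α.1 = ∑' n, out n := by
    rw [hout, ENNReal.tsum_comm]
    have : ∀ α : List E, (∑' n, if α.length = n then (if S.IsMaxTrace α then R α else 0) else 0) =
        {α | S.IsMaxTrace α}.indicator R α := fun α => by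
      simp_rw [eq_comm (a := α.length)]
      rw [tsum_ite_eq]
      rfl
    simp_rw [this]
    exact tsum_subtype {α | S.IsMaxTrace α} R
  rw [total]
  exact ENNReal.tsum_le_of_sum_range_le fun n => le_add_self.trans (bound n)

theorem summable_sum_run (h : S.IsWeight σ w) (s : Ω) :
    Summable fun α : {α // S.IsMaxTrace α} => ∑ u, run σ s α.1 u := by
  have := ENNReal.summable_toReal
    ((h.tsum_isMaxTrace_le_one s).trans_lt ENNReal.one_lt_top).ne
  refine this.congr fun α => ?_
  exact ENNReal.toReal_ofReal (sum_nonneg fun u _ => h.run_nonneg s α.1 u)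

theorem hasSum_behaviour (h : S.IsWeight σ w) (s u : Ω) :
    HasSum (fun α : {α // S.IsMaxTrace α} => run σ s α.1 u) (S.behaviour σ s u) := by
  refine (Summable.of_nonneg_of_le (fun α => h.run_nonneg s α.1 u) (fun α => ?_)
    (h.summable_sum_run s)).hasSum
  exact single_le_sum (f := fun u => run σ s α.1 u) (fun u _ => h.run_nonneg s α.1 u) (mem_univ u)

theorem behaviour_nonneg (h : S.IsWeight σ w) (s u : Ω) : 0 ≤ S.behaviour σ s u :=
  tsum_nonneg fun α => h.run_nonneg s α.1 u

theorem sum_behaviour_le_one (h : S.IsWeight σ w) (s : Ω) : ∑ u, S.behaviour σ s u ≤ 1 := by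
  have h1 := hasSum_sum (s := univ) fun u _ => h.hasSum_behaviour s u
  rw [← h1.tsum_eq, ← ENNReal.ofReal_le_ofReal_iff zero_le_one, ENNReal.ofReal_one,
    ENNReal.ofReal_tsum_of_nonneg (fun α => sum_nonneg fun u _ => h.run_nonneg s α.1 u)
      h1.summable]
  exact h.tsum_isMaxTrace_le_one s

end IsWeight

/-! ### Runs from an initial mass, and flows. -/

/-- The run of `σ` from the initial mass `ν`. -/
noncomputable def runFrom (σ : List E → E → Ω → (Ω → ℝ)) (ν : Ω → ℝ) (α : List E) (u : Ω) : ℝ :=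
  ∑ s, ν s * run σ s α u

theorem runFrom_nil (σ : List E → E → Ω → (Ω → ℝ)) (ν : Ω → ℝ) (u : Ω) :
    runFrom σ ν [] u = ν u := by
  classical
  simp [runFrom, run_nil, pointDist]

theorem runFrom_concat (σ : List E → E → Ω → (Ω → ℝ)) (ν : Ω → ℝ) (α : List E) (e : E) (u : Ω) :
    runFrom σ ν (α ++ [e]) u = ∑ t, runFrom σ ν α t * σ α e t u := by
  simp_rw [runFrom, run_concat, sum_mul, mul_sum]
  rw [sum_comm]
  exact sum_congr rfl fun t _ => sum_congr rfl fun s _ => by ring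

theorem IsWeight.runFrom_nonneg {σ : List E → E → Ω → (Ω → ℝ)} {w : List E → E → Ω → ℝ}
    (h : S.IsWeight σ w) {ν : Ω → ℝ} (hν : ∀ s, 0 ≤ ν s) (α : List E) (u : Ω) :
    0 ≤ runFrom σ ν α u :=
  sum_nonneg fun s _ => mul_nonneg (hν s) (h.run_nonneg s α u)

theorem IsWeight.hasSum_runFrom {σ : List E → E → Ω → (Ω → ℝ)} {w : List E → E → Ω → ℝ}
    (h : S.IsWeight σ w) (ν : Ω → ℝ) (u : Ω) :
    HasSum (fun α : {α // S.IsMaxTrace α} => runFrom σ ν α.1 u)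
      (∑ s, ν s * S.behaviour σ s u) :=
  hasSum_sum fun s _ => (h.hasSum_behaviour s u).mul_left (ν s)

/-- A flow on `T` with initial mass `ν`: `M β u` is the mass passing through the trace `β` in state
`u`, and `X β e u` is the mass, of total amount `W β e u`, that leaves it along the event `e`. -/
structure IsFlow (T : IPBES Ω F) (ν : Ω → ℝ) (M : List F → Ω → ℝ) (W : List F → F → Ω → ℝ)
    (X : List F → F → Ω → (Ω → ℝ)) : Prop where
  nil : ∀ u, M [] u = ν u
  concat : ∀ β e, T.IsTrace (β ++ [e]) → ∀ v, M (β ++ [e]) v = ∑ u, X β e u v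
  scaledMem : ∀ β e u, T.IsTrace (β ++ [e]) → ScaledMem (T.label e u) (W β e u) (X β e u)
  off_dom : ∀ β e u, ¬ T.IsTrace (β ++ [e]) → W β e u = 0
  hasSum : ∀ β, T.IsTrace β → ¬ T.IsMaxTrace β → ∀ u, HasSum (fun e => W β e u) (M β u)

/-- Every flow is the run of a scheduler, given some scheduler to be used where there is no mass. -/
theorem IsFlow.exists_scheduler {ν : Ω → ℝ} {M : List F → Ω → ℝ} {W : List F → F → Ω → ℝ}
    {X : List F → F → Ω → (Ω → ℝ)} (h : T.IsFlow ν M W X) {τ₀ : List F → F → Ω → (Ω → ℝ)}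
    {w₀ : List F → F → Ω → ℝ} (h₀ : T.IsWeight τ₀ w₀) :
    ∃ τ w, T.IsWeight τ w ∧ ∀ β, T.IsTrace β → ∀ u, runFrom τ ν β u = M β u := by
  classical
  have W_nonneg : ∀ β e u, 0 ≤ W β e u := fun β e u => by
    by_cases he : T.IsTrace (β ++ [e])
    · exact (h.scaledMem β e u he).nonneg
    · exact (h.off_dom β e u he).ge
  have M_nonneg : ∀ β, T.IsTrace β → ¬ T.IsMaxTrace β → ∀ u, 0 ≤ M β u := fun β hβ hm u =>
    (h.hasSum β hβ hm u).nonneg fun e => W_nonneg β e u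
  let τ : List F → F → Ω → (Ω → ℝ) := fun β e u =>
    if T.IsTrace (β ++ [e]) then if M β u = 0 then τ₀ β e u else (M β u)⁻¹ • X β e u else 0
  let w : List F → F → Ω → ℝ := fun β e u =>
    if M β u = 0 then w₀ β e u else (M β u)⁻¹ * W β e u
  have hw : T.IsWeight τ w := by
    refine ⟨fun β e u he => ?_, fun β e u he => ?_, fun β hβ hm u => ?_⟩
    · simp only [τ, w, if_pos he]
      split_ifs with hM
      · exact h₀.scaledMem β e u he
      · exact (h.scaledMem β e u he).smul
          (inv_nonneg.2 (M_nonneg β he.of_concat he.not_isMaxTrace u))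
    · simp [τ, w, he, h.off_dom β e u he, h₀.off_dom β e u he]
    · simp only [w]
      split_ifs with hM
      · exact h₀.hasSum β hβ hm u
      · simpa [hM] using (h.hasSum β hβ hm u).mul_left (M β u)⁻¹
  refine ⟨τ, w, hw, fun β => ?_⟩
  induction β using List.reverseRecOn with
  | nil => exact fun _ u => by rw [runFrom_nil, h.nil]
  | append_singleton β e ih =>
    intro he v
    rw [runFrom_concat, h.concat β e he]
    refine sum_congr rfl fun u _ => ?_
    rw [ih he.of_concat u]
    simp only [τ, if_pos he]
    split_ifs with hM
    -- With no mass at `β` in state `u`, the nonnegative outgoing weights sum to zero, so nothing is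
    -- transferred and the choice of `τ₀` is harmless.
    · have hs := h.hasSum β he.of_concat he.not_isMaxTrace u
      rw [hM, hasSum_zero_iff_of_nonneg fun e => W_nonneg β e u] at hs
      rw [(h.scaledMem β e u he).eq_zero (congrFun hs e), hM]
      simp
    · simp [hM]

/-! ### Simulations with chosen completions. -/

/-- A t-simulation as a function on lists of events, together with the choice, for each maximal
trace `α` of `S`, of a maximal trace `c α` completing the weakly maximal trace `f α`. -/
structure IsListSimulation (S : IPBES Ω E) (T : IPBES Ω F) (f c : List E → List F) : Prop where
  nil : f [] = []
  isTrace : ∀ α, S.IsTrace α → T.IsTrace (f α)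
  finite_fibers : ∀ β, {α | S.IsTrace α ∧ f α = β}.Finite
  step : ∀ α e, S.IsTrace (α ++ [e]) → (f (α ++ [e]) = f α ∧ ProgRefines (S.label e) skipProg) ∨
    ∃ e', ProgRefines (S.label e) (T.label e') ∧ f (α ++ [e]) = f α ++ [e']
  prefix_completion : ∀ α, S.IsMaxTrace α → f α <+: c α
  isMaxTrace_completion : ∀ α, S.IsMaxTrace α → T.IsMaxTrace (c α)
  skip : ∀ α, S.IsMaxTrace α → ∀ β e', f α <+: β → β ++ [e'] <+: c α →
    ProgRefines skipProg (T.label e')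

theorem IsTSimulation.exists_isListSimulation {f : S.Trace → T.Trace} (h : S.IsTSimulation T f)
    (hS : S.NonZero) : ∃ f c, S.IsListSimulation T f c := by
  classical
  let g : List E → List F := fun α => if hα : S.IsTrace α then (f ⟨α, hα⟩).1 else []
  have g_eq : ∀ α (hα : S.IsTrace α), g α = (f ⟨α, hα⟩).1 := fun α hα => dif_pos hα
  have weak : ∀ α, S.IsMaxTrace α → T.IsWeaklyMaxTrace (g α) := fun α hα => by
    rcases α.eq_nil_or_concat' with rfl | ⟨a, e, rfl⟩
    -- The `max` clause speaks only of nonempty traces; non-zeroness prevents the empty trace from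
    -- being maximal.
    · obtain ⟨e, he⟩ := hS
      exact absurd he (hα.not_isTrace_concat e)
    · rw [g_eq _ hα.1]
      exact (h.max ⟨a, hα.1.of_concat⟩ ⟨_, hα.1⟩ e rfl hα).2
  choose! l hl using fun α hα => (weak α hα).2
  refine ⟨g, fun α => g α ++ l α, ?_, ?_, ?_, ?_, ?_, ?_, ?_⟩
  · rw [g_eq [] S.isTrace_nil]
    exact h.nil _ rfl
  · intro α hα
    rw [g_eq α hα]
    exact (f ⟨α, hα⟩).2
  · intro β
    by_cases hβ : T.IsTrace β
    · refine ((h.finite_fibers ⟨β, hβ⟩).image Subtype.val).subset ?_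
      rintro α ⟨hα, rfl⟩
      exact ⟨⟨α, hα⟩, Subtype.ext (g_eq α hα).symm, rfl⟩
    · refine Set.finite_empty.subset ?_
      rintro α ⟨hα, rfl⟩
      exact hβ (g_eq α hα ▸ (f ⟨α, hα⟩).2)
  · intro α e he
    rw [g_eq _ he, g_eq _ he.of_concat]
    exact (h.step ⟨α, he.of_concat⟩ ⟨_, he⟩ e rfl).imp_left fun h' => ⟨congrArg _ h'.1, h'.2⟩
  · exact fun α _ => List.prefix_append _ _
  · exact fun α hα => (hl α hα).1
  · rintro α hα β e' ⟨b, rfl⟩ hp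
    refine (hl α hα).2 e' ?_
    rw [List.append_assoc, List.prefix_append_right_inj] at hp
    exact hp.subset (by simp)

namespace IsListSimulation

variable {f c : List E → List F} (h : S.IsListSimulation T f c)

/-! ### Fibers of the simulation and conservation of mass. -/

/-- The traces mapped to `β`. -/
noncomputable def fiber (β : List F) : Finset (List E) := (h.finite_fibers β).toFinset

theorem mem_fiber {β : List F} {α : List E} : α ∈ h.fiber β ↔ S.IsTrace α ∧ f α = β := by
  simp [fiber]

/-- The events extending `α` to a trace mapped to `β`. -/
noncomputable def next (α : List E) (β : List F) : Finset E :=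
  (h.fiber β).preimage (fun e => α ++ [e])
    (Function.Injective.injOn fun e e' hee => by simpa using hee)

theorem mem_next {α : List E} {β : List F} {e : E} :
    e ∈ h.next α β ↔ S.IsTrace (α ++ [e]) ∧ f (α ++ [e]) = β := by
  rw [next, Finset.mem_preimage, mem_fiber]

theorem finite_done (h : S.IsListSimulation T f c) (β : List F) : {α | S.IsMaxTrace α ∧ f α <+: β}.Finite := by
  classical
  refine (β.inits.toFinset.biUnion h.fiber).finite_toSet.subset fun α hα => ?_
  simpa [mem_fiber] using ⟨hα.1.1, hα.2⟩

/-- The maximal traces mapped to a prefix of `β`. -/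
noncomputable def done (β : List F) : Finset (List E) := (h.finite_done β).toFinset

theorem mem_done {β : List F} {α : List E} :
    α ∈ h.done β ↔ S.IsMaxTrace α ∧ f α <+: β := by
  simp [done]

theorem sum_next (A : Finset (List E)) (β : List F) (g : List E → ℝ) :
    ∑ α ∈ A, ∑ e ∈ h.next α β, g (α ++ [e]) =
      open Classical in ∑ α ∈ h.fiber β with α ≠ [] ∧ α.dropLast ∈ A, g α := by
  classical
  rw [sum_sigma']
  refine sum_nbij (fun p => p.1 ++ [p.2]) ?_ ?_ ?_ fun _ _ => rfl
  · rintro ⟨α, e⟩ hp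
    simp only [mem_sigma, mem_next] at hp
    simp [mem_fiber, hp]
  · rintro ⟨α, e⟩ - ⟨α', e'⟩ - hp
    simpa using hp
  · intro α hα
    rcases α.eq_nil_or_concat' with rfl | ⟨a, e, rfl⟩
    · simp at hα
    · refine ⟨⟨a, e⟩, ?_, rfl⟩
      simpa [mem_next, mem_fiber, and_comm] using hα

/-- The predecessor of a trace over `β ++ [e']` lies over the same list or over `β`, by `step`. The
two sums thus separate internal moves from entries into the fiber. -/
theorem sum_fiber_concat (β : List F) (e' : F) (g : List E → ℝ) :
    ∑ α ∈ h.fiber (β ++ [e']), g α =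
      ∑ α ∈ h.fiber (β ++ [e']), ∑ e ∈ h.next α (β ++ [e']), g (α ++ [e]) +
      ∑ α ∈ h.fiber β, ∑ e ∈ h.next α (β ++ [e']), g (α ++ [e]) := by
  classical
  have hd : Disjoint (h.fiber (β ++ [e'])) (h.fiber β) := by
    rw [disjoint_left]
    intro α h1 h2
    rw [mem_fiber] at h1 h2
    simpa using h1.2.symm.trans h2.2
  rw [← sum_union hd, sum_next]
  symm
  refine sum_congr (filter_true_of_mem fun α hα => ?_) fun _ _ => rfl
  rw [mem_fiber] at hα
  rcases α.eq_nil_or_concat' with rfl | ⟨a, e, rfl⟩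
  · simp [h.nil] at hα
  · refine ⟨by simp, ?_⟩
    simp only [List.dropLast_concat, mem_union, mem_fiber, hα.1.of_concat, true_and]
    rcases h.step a e hα.1 with h' | ⟨e'', -, h'⟩
    · exact Or.inl (h'.1.symm.trans hα.2)
    · exact Or.inr (List.append_inj_left' (h'.symm.trans hα.2) rfl)

theorem sum_fiber_nil (g : List E → ℝ) :
    ∑ α ∈ h.fiber [], g α =
      g [] + ∑ α ∈ h.fiber [], ∑ e ∈ h.next α [], g (α ++ [e]) := by
  classical
  rw [sum_next, ← add_sum_erase _ _ (h.mem_fiber.2 ⟨S.isTrace_nil, h.nil⟩)]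
  congr 1
  refine sum_congr ?_ fun _ _ => rfl
  ext α
  rw [mem_erase, mem_filter, and_comm]
  refine and_congr_right fun hα => ⟨fun hne => ⟨hne, ?_⟩, fun h' => h'.1⟩
  rw [mem_fiber] at hα ⊢
  rcases α.eq_nil_or_concat' with rfl | ⟨a, e, rfl⟩
  · simp at hne
  · rw [List.dropLast_concat]
    refine ⟨hα.1.of_concat, ?_⟩
    rcases h.step a e hα.1 with h' | ⟨e'', -, h'⟩
    · exact h'.1.symm.trans hα.2
    · simpa using h'.symm.trans hα.2

variable {σ : List E → E → Ω → (Ω → ℝ)} {w : List E → E → Ω → ℝ}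

/-- Discard the events collapsed by `f` from a family of total weight one and group the rest by
image; each image is `f α` followed by one event. -/
theorem hasSum_next (hw : S.IsWeight σ w) {α : List E} (hα : S.IsTrace α) (hm : ¬ S.IsMaxTrace α) (u : Ω) :
    HasSum (fun e' => ∑ e ∈ h.next α (f α ++ [e']), w α e u)
      (1 - ∑ e ∈ h.next α (f α), w α e u) := by
  classical
  set w' : E → ℝ := fun e => w α e u - if e ∈ h.next α (f α) then w α e u else 0 with hw'
  have h1 : HasSum w' (1 - ∑ e ∈ h.next α (f α), w α e u) := by
    refine (hw.hasSum α hα hm u).sub ?_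
    rw [← sum_congr rfl fun e he => if_pos he]
    exact hasSum_sum_of_ne_finset_zero fun e he => if_neg he
  have h2 := h1.tsum_fiberwise fun e => f (α ++ [e])
  have inj : Function.Injective fun e' : F => f α ++ [e'] := fun a b hab => by simpa using hab
  have off : ∀ e, ¬ S.IsTrace (α ++ [e]) → w' e = 0 := fun e he => by
    simp [hw', (hw.off_dom α e u he).1]
  rw [← inj.hasSum_iff] at h2
  · refine Eq.subst (motive := fun g => HasSum g _) (funext fun e' => ?_) h2
    rw [Function.comp_apply, tsum_subtype ((fun e => f (α ++ [e])) ⁻¹' {f α ++ [e']}) w',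
      tsum_eq_sum (s := h.next α (f α ++ [e']))]
    · refine sum_congr rfl fun e he => ?_
      rw [mem_next] at he
      rw [Set.indicator_of_mem (by exact he.2), hw']
      simp [mem_next, he.2]
    · intro e he
      rw [mem_next, not_and] at he
      by_cases ht : S.IsTrace (α ++ [e])
      · exact Set.indicator_of_notMem (s := (fun e => f (α ++ [e])) ⁻¹' {f α ++ [e']}) (he ht) w'
      · simp [Set.indicator_apply, off e ht]
  · intro γ hγ
    have h0 : ∀ e : (fun e => f (α ++ [e])) ⁻¹' {γ}, w' e = 0 := by
      rintro ⟨e, he⟩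
      by_cases ht : S.IsTrace (α ++ [e])
      · rcases h.step α e ht with h' | ⟨e', -, h'⟩
        · simp [hw', mem_next, ht, h'.1]
        · exact absurd ⟨e', h'.symm.trans he⟩ hγ
      · exact off e ht
    exact (tsum_congr h0).trans tsum_zero

/-- A collapsed event has label inside `δ`, so it acts on each state as multiplication by its
weight. -/
theorem runFrom_concat_of_mem_next (hw : S.IsWeight σ w) {ν : Ω → ℝ} {α : List E} {e : E} 
    (he : e ∈ h.next α (f α)) (u : Ω) : runFrom σ ν (α ++ [e]) u = runFrom σ ν α u * w α e u := by
  classical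
  rw [mem_next] at he
  have hskip : ProgRefines (S.label e) skipProg := by
    rcases h.step α e he.1 with h' | ⟨e', -, h'⟩
    · exact h'.2
    · simpa using h'.symm.trans he.2
  have hσ : ∀ t, σ α e t = w α e t • pointDist t := fun t => by
    rcases hw.scaledMem α e t he.1 with h' | ⟨-, μ, hμ, h'⟩
    · simp [h']
    · rw [h', Set.mem_singleton_iff.1 (hskip t hμ)]
  rw [runFrom_concat]
  simp [hσ, pointDist]

/-- Conservation of mass in the fiber over `β`. -/
theorem hasSum_exit (hw : S.IsWeight σ w) (ν : Ω → ℝ) (β : List F) (u : Ω) :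
    HasSum (fun e' => ∑ α ∈ h.fiber β, runFrom σ ν α u * ∑ e ∈ h.next α (β ++ [e']), w α e u)
      (∑ α ∈ h.fiber β, runFrom σ ν α u
        - ∑ α ∈ h.fiber β, ∑ e ∈ h.next α β, runFrom σ ν (α ++ [e]) u
        - open Classical in ∑ α ∈ h.fiber β with S.IsMaxTrace α, runFrom σ ν α u) := by
  classical
  rw [sum_filter, ← sum_sub_distrib, ← sum_sub_distrib]
  refine hasSum_sum fun α hα => ?_
  rw [mem_fiber] at hα
  obtain ⟨hα, rfl⟩ := hα
  rw [sum_congr rfl fun e he => h.runFrom_concat_of_mem_next hw he u, ← mul_sum]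
  by_cases hm : S.IsMaxTrace α
  · have : ∀ β, h.next α β = ∅ := fun β => eq_empty_of_forall_notMem fun e he =>
      hm.not_isTrace_concat e (h.mem_next.1 he).1
    simp [this, hm]
  · rw [if_neg hm, sub_zero, ← mul_one_sub]
    exact (h.hasSum_next hw hα hm u).mul_left (runFrom σ ν α u)

open Classical in
-- Completions passing through `β` either began strictly earlier or begin at `β` itself, in which
-- case they come from the maximal traces in the fiber.
theorem sum_done_filter (g : List E → ℝ) (β : List F) :
    ∑ α ∈ h.done β with β <+: c α, g α =
      ∑ α ∈ h.done β with f α ≠ β ∧ β <+: c α, g α +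
        ∑ α ∈ h.fiber β with S.IsMaxTrace α, g α := by
  rw [← sum_filter_add_sum_filter_not ({α ∈ h.done β | β <+: c α}) (fun α => f α ≠ β) g]
  rw [filter_filter, filter_filter]
  congr 1
  · exact sum_congr (by ext; simp [and_comm]) fun _ _ => rfl
  · refine sum_congr ?_ fun _ _ => rfl
    ext α
    simp only [mem_filter, mem_done, mem_fiber, not_not]
    constructor
    · rintro ⟨⟨hm, -⟩, -, hf⟩
      exact ⟨⟨hm.1, hf⟩, hm⟩
    · rintro ⟨⟨-, rfl⟩, hm⟩
      exact ⟨⟨hm, List.prefix_rfl⟩, h.prefix_completion α hm, rfl⟩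

open Classical in
-- A maximal completion passing through a non-maximal `β` leaves it along exactly one event.
theorem hasSum_done (g : List E → ℝ) {β : List F} (hβ : ¬ T.IsMaxTrace β) :
    HasSum (fun e' => ∑ α ∈ h.done β with β ++ [e'] <+: c α, g α)
      (∑ α ∈ h.done β with β <+: c α, g α) := by
  simp_rw [sum_filter]
  refine hasSum_sum fun α hα => ?_
  rw [mem_done] at hα
  by_cases hp : β <+: c α
  · obtain ⟨l, hl⟩ := hp
    cases l with
    | nil => exact absurd (h.isMaxTrace_completion α hα.1) (by simpa [← hl] using hβ)
    | cons e l =>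
      have : ∀ e', β ++ [e'] <+: c α ↔ e' = e := fun e' => by
        rw [← hl, List.prefix_append_right_inj]
        simp
      simp_rw [this, if_pos (show β <+: c α from ⟨_, hl⟩)]
      exact hasSum_ite_eq e (g α)
  · have : ∀ e', ¬ β ++ [e'] <+: c α := fun e' h' => hp ((List.prefix_append _ _).trans h')
    simp only [this, hp, if_false]
    exact hasSum_zero

/-! ### The flow induced by a simulation. -/

/-- The mass passing through `β` in the simulating event structure: what enters the fiber over `β`,
and what completes the images of maximal traces. -/
noncomputable def mass (σ : List E → E → Ω → (Ω → ℝ)) (ν : Ω → ℝ) (β : List F) (u : Ω) : ℝ :=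
  open Classical in
  ∑ α ∈ h.fiber β, runFrom σ ν α u
    - ∑ α ∈ h.fiber β, ∑ e ∈ h.next α β, runFrom σ ν (α ++ [e]) u
    + ∑ α ∈ h.done β with f α ≠ β ∧ β <+: c α, runFrom σ ν α u

/-- The amount of mass leaving `β` along `e'` in state `u`. -/
noncomputable def weight (σ : List E → E → Ω → (Ω → ℝ)) (w : List E → E → Ω → ℝ) (ν : Ω → ℝ)
    (β : List F) (e' : F) (u : Ω) : ℝ :=
  open Classical in
  ∑ α ∈ h.fiber β, runFrom σ ν α u * ∑ e ∈ h.next α (β ++ [e']), w α e u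
    + ∑ α ∈ h.done β with β ++ [e'] <+: c α, runFrom σ ν α u

/-- The mass leaving `β` along `e'` in state `u`, according to the next state. -/
noncomputable def transfer (σ : List E → E → Ω → (Ω → ℝ)) (ν : Ω → ℝ)
    (β : List F) (e' : F) (u : Ω) : Ω → ℝ :=
  open Classical in
  ∑ α ∈ h.fiber β, runFrom σ ν α u • ∑ e ∈ h.next α (β ++ [e']), σ α e u
    + (∑ α ∈ h.done β with β ++ [e'] <+: c α, runFrom σ ν α u) • pointDist u

/-- Nothing can exit the fiber over a maximal `β`, so by `hasSum_exit` all mass entering it stops at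
maximal traces of `S`. -/
theorem mass_of_isMaxTrace (hw : S.IsWeight σ w) (ν : Ω → ℝ) {β : List F} (hβ : T.IsMaxTrace β)
    (u : Ω) : h.mass σ ν β u =
      open Classical in ∑ α ∈ h.done β with β <+: c α, runFrom σ ν α u := by
  classical
  have hnext : ∀ α e', h.next α (β ++ [e']) = ∅ := fun α e' =>
    eq_empty_of_forall_notMem fun e he => by
      rw [mem_next] at he
      exact hβ.not_isTrace_concat e' (he.2 ▸ h.isTrace _ he.1)
  have h0 := h.hasSum_exit hw ν β u
  simp only [hnext, sum_empty, mul_zero, sum_const_zero] at h0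
  rw [sum_done_filter, mass]
  linarith [h0.unique hasSum_zero]

theorem isFlow (hw : S.IsWeight σ w) {ν : Ω → ℝ} (hν : ∀ s, 0 ≤ ν s) :
    T.IsFlow ν (h.mass σ ν) (h.weight σ w ν) (h.transfer σ ν) where
  nil u := by
    classical
    rw [mass, h.sum_fiber_nil fun α => runFrom σ ν α u, runFrom_nil, add_sub_cancel_right,
      filter_false_of_mem, sum_empty, add_zero]
    rintro α hα ⟨hne, -⟩
    exact hne (List.prefix_nil.1 (h.mem_done.1 hα).2)
  concat β e' _ v := by
    classical
    simp only [mass, transfer, Pi.add_apply, Finset.sum_apply, Pi.smul_apply, smul_eq_mul,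
      sum_add_distrib]
    -- Internal moves cancel, leaving the entries from the fiber over `β`.
    rw [h.sum_fiber_concat β e' fun α => runFrom σ ν α v, add_sub_cancel_left]
    congr 1
    · rw [sum_comm]
      refine sum_congr rfl fun α _ => ?_
      simp_rw [mul_sum]
      rw [sum_comm]
      exact sum_congr rfl fun e _ => runFrom_concat σ ν α e v
    · simp only [pointDist, mul_ite, mul_one, mul_zero, sum_ite_eq, mem_univ, if_true]
      refine sum_congr ?_ fun _ _ => rfl
      ext α
      simp only [mem_filter, mem_done, List.prefix_concat_iff]
      constructor
      · rintro ⟨⟨hm, hf | hf⟩, hne, hc⟩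
        exacts [absurd hf hne, ⟨⟨hm, hf⟩, hc⟩]
      · rintro ⟨⟨hm, hf⟩, hc⟩
        refine ⟨⟨hm, Or.inr hf⟩, fun hne => ?_, hc⟩
        simpa [hne] using hf.length_le
  scaledMem β e' u _ := by
    classical
    have hconv := T.convex_label e' u
    refine ScaledMem.add hconv (ScaledMem.sum hconv fun α hα => ScaledMem.smul
      (ScaledMem.sum hconv fun e he => ?_) (hw.runFrom_nonneg hν α u)) ?_
    · rw [mem_fiber] at hα
      rw [mem_next] at he
      refine (hw.scaledMem α e u he.1).mono ?_
      rcases h.step α e he.1 with h' | ⟨e'', hr, h'⟩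
      · have := h'.1.symm.trans he.2
        simp [hα.2] at this
      · have := h'.symm.trans he.2
        rw [hα.2] at this
        obtain rfl : e'' = e' := by simpa using this
        exact hr u
    · rcases ({α ∈ h.done β | β ++ [e'] <+: c α}).eq_empty_or_nonempty with h0 | ⟨α, hα⟩
      · rw [h0]
        simpa using ScaledMem.zero
      · rw [mem_filter, mem_done] at hα
        -- A completing event admits `δ`, so the stopped mass may cross it without changing state.
        exact ScaledMem.of_mem (h.skip α hα.1.1 β e' hα.1.2 hα.2 u rfl)
          (sum_nonneg fun α _ => hw.runFrom_nonneg hν α u)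
  off_dom β e' u he' := by
    classical
    have h1 : ∀ α, h.next α (β ++ [e']) = ∅ := fun α =>
      eq_empty_of_forall_notMem fun e he => by
        rw [mem_next] at he
        exact he' (he.2 ▸ h.isTrace _ he.1)
    have h2 : {α ∈ h.done β | β ++ [e'] <+: c α} = ∅ := filter_false_of_mem fun α hα hp =>
      he' ((h.isMaxTrace_completion α (h.mem_done.1 hα).1).1.of_prefix hp)
    simp [weight, h1, h2]
  hasSum β _ hm u := by
    classical
    -- The mass stopped in the fiber, subtracted by the first balance, is what the second sends
    -- along completions.
    have h1 := (h.hasSum_exit hw ν β u).add (h.hasSum_done (fun α => runFrom σ ν α u) hm)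
    rw [sum_done_filter, add_comm (∑ α ∈ h.done β with f α ≠ β ∧ β <+: c α, _),
      ← add_assoc, sub_add_cancel] at h1
    exact h1

/-- Group the maximal traces of `S` by completion: the mass at a maximal `β` is exactly the mass of
those `α` with `c α = β`. -/
theorem hasSum_mass (hw : S.IsWeight σ w) (ν : Ω → ℝ) (u : Ω) :
    HasSum (fun β : {β // T.IsMaxTrace β} => h.mass σ ν β.1 u)
      (∑ s, ν s * S.behaviour σ s u) := by
  classical
  set g : List E → ℝ := {α | S.IsMaxTrace α}.indicator fun α => runFrom σ ν α u with hg
  have h1 : HasSum g (∑ s, ν s * S.behaviour σ s u) :=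
    hasSum_subtype_iff_indicator.1 (hw.hasSum_runFrom ν u)
  have h2 := h1.tsum_fiberwise c
  rw [← (Subtype.val_injective (p := T.IsMaxTrace)).hasSum_iff] at h2
  · refine Eq.subst (motive := fun g => HasSum g _) (funext fun β => ?_) h2
    rw [Function.comp_apply, tsum_subtype (c ⁻¹' {β.1}) g, h.mass_of_isMaxTrace hw ν β.2,
      tsum_eq_sum (s := {α ∈ h.done β.1 | β.1 <+: c α})]
    · refine sum_congr rfl fun α hα => ?_
      rw [mem_filter, mem_done] at hα
      have hc : c α = β.1 := β.2.2 _ (h.isMaxTrace_completion α hα.1.1).1 hα.2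
      rw [Set.indicator_of_mem (by exact hc), hg, Set.indicator_of_mem (by exact hα.1.1)]
    · intro α hα
      by_cases hm : S.IsMaxTrace α
      · refine Set.indicator_of_notMem (fun hc => hα ?_) _
        rw [Set.mem_preimage, Set.mem_singleton_iff] at hc
        rw [mem_filter, mem_done, ← hc]
        exact ⟨⟨hm, h.prefix_completion α hm⟩, List.prefix_rfl⟩
      · have : g α = 0 := Set.indicator_of_notMem (s := {α | S.IsMaxTrace α}) hm _
        simp [Set.indicator_apply, this]
  · intro γ hγ
    have h0 : ∀ α : c ⁻¹' {γ}, g α = 0 := by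
      rintro ⟨α, hα⟩
      refine Set.indicator_of_notMem (fun hm => hγ ?_) _
      exact ⟨⟨γ, hα ▸ h.isMaxTrace_completion α hm⟩, rfl⟩
    exact (tsum_congr h0).trans tsum_zero

/-! ### Matching and approximating behaviours. -/

/-- The behaviours of a scheduler of `S`, averaged over a positive initial mass, are matched by a
scheduler of `T`. -/
theorem exists_mem_sched₁ (h : S.IsListSimulation T f c) (hσ : σ ∈ S.Sched₁) (hT : T.Terminating) {ν : Ω → ℝ}
    (hν : ∀ s, 0 < ν s) :
    ∃ τ ∈ T.Sched₁, ∀ u, ∑ s, ν s * T.behaviour τ s u = ∑ s, ν s * S.behaviour σ s u := by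
  obtain ⟨w, hw⟩ := hσ.1.exists_isWeight
  obtain ⟨τ₀, hτ₀, -⟩ := hT
  obtain ⟨w₀, hw₀⟩ := hτ₀.exists_isWeight
  obtain ⟨τ, v, hv, hrun⟩ := (h.isFlow hw fun s => (hν s).le).exists_scheduler hw₀
  have key : ∀ u, ∑ s, ν s * T.behaviour τ s u = ∑ s, ν s * S.behaviour σ s u := fun u => by
    refine (hv.hasSum_runFrom ν u).unique ?_
    simp_rw [fun β : {β // T.IsMaxTrace β} => hrun β.1 β.2.1 u]
    exact h.hasSum_mass hw ν u
  refine ⟨τ, ⟨hv.isScheduler, fun s => ⟨hv.behaviour_nonneg s, ?_⟩⟩, key⟩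
  have total : ∑ s, ν s * ∑ u, T.behaviour τ s u = ∑ s, ν s * 1 := by
    simp_rw [mul_sum]
    rw [sum_comm, sum_congr rfl fun u _ => key u, sum_comm]
    simp_rw [← mul_sum, fun s => (hσ.2 s).2]
  -- Termwise inequality with equal sums gives termwise equality; positivity of `ν s` then cancels.
  have := (sum_eq_sum_iff_of_le fun s _ =>
    mul_le_mul_of_nonneg_left (hv.sum_behaviour_le_one s) (hν s).le).1 total s (mem_univ s)
  exact mul_left_cancel₀ (hν s).ne' this

theorem behaviour_mem_closure (h : S.IsListSimulation T f c) (hσ : σ ∈ S.Sched₁)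
    (hT : T.Terminating) (s : Ω) :
    S.behaviour σ s ∈ closure {μ | ∃ τ ∈ T.Sched₁, μ = T.behaviour τ s} := by
  classical
  have : Nonempty Ω := ⟨s⟩
  rw [Metric.mem_closure_iff]
  intro ε hε
  set n : ℝ := (Fintype.card Ω : ℝ) with hn
  have hn0 : 0 < n := by simp [hn, Fintype.card_pos]
  -- The perturbation adds to each side `d` times a sum of `n` numbers in `[0, 1]`, so the
  -- behaviours at `s` differ by at most `d * n = ε / 2` in each coordinate.
  set d : ℝ := ε / (2 * n) with hd
  have hd0 : 0 < d := by positivity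
  obtain ⟨τ, hτ, key⟩ := h.exists_mem_sched₁ hσ hT (ν := fun t => pointDist s t + d) fun t =>
    add_pos_of_nonneg_of_pos ((pointDist_mem_stdSimplex s).1 t) hd0
  refine ⟨_, ⟨τ, hτ, rfl⟩, (dist_pi_lt_iff hε).2 fun u => ?_⟩
  have expand : ∀ b : Ω → ℝ, ∑ t, (pointDist s t + d) * b t = b s + d * ∑ t, b t := fun b => by
    simp [add_mul, sum_add_distrib, mul_sum, pointDist]
  have hu := key u
  rw [expand fun t => T.behaviour τ t u, expand fun t => S.behaviour σ t u] at hu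
  have bound : ∀ b : Ω → ℝ, (∀ t, 0 ≤ b t ∧ b t ≤ 1) → 0 ≤ ∑ t, b t ∧ ∑ t, b t ≤ n :=
    fun b hb => ⟨sum_nonneg fun t _ => (hb t).1, by
      simpa [hn] using sum_le_sum fun t (_ : t ∈ univ) => (hb t).2⟩
  have hS := bound (fun t => S.behaviour σ t u) fun t =>
    mem_Icc_of_mem_stdSimplex (hσ.2 t) u
  have hTb := bound (fun t => T.behaviour τ t u) fun t =>
    mem_Icc_of_mem_stdSimplex (hτ.2 t) u
  have hdn : d * n = ε / 2 := by rw [hd]; field_simp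
  rw [Real.dist_eq, abs_lt]
  have h1 := mul_le_mul_of_nonneg_left hS.2 hd0.le
  have h2 := mul_le_mul_of_nonneg_left hTb.2 hd0.le
  have h3 := mul_nonneg hd0.le hS.1
  have h4 := mul_nonneg hd0.le hTb.1
  constructor <;> linarith

end IsListSimulation

/-! ### The semantics as a program, and the conclusion. -/

theorem Terminating.isProgram_sem (hS : S.Terminating) : IsProgram S.sem where
  subset_dist s := by
    refine closure_minimal (convexHull_min ?_ (convex_stdSimplex ℝ Ω)) (isClosed_stdSimplex ℝ Ω)
    rintro _ ⟨σ, hσ, rfl⟩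
    exact hσ.2 s
  nonempty s := by
    obtain ⟨σ, hσ⟩ := hS
    exact ⟨_, subset_closure (subset_convexHull ℝ _ ⟨σ, hσ, rfl⟩)⟩
  isClosed s := isClosed_closure
  convex s := (convex_convexHull ℝ _).closure

end IPBES


/-- For feasible, terminating event structures `S` (non-zero) and `T`, a t-simulation from `S` to `T`
implies that `⟦S⟧` refines `⟦T⟧` in `ℍ₁Ω`. -/
theorem mainTheorem1 {Ω : Type*} [Fintype Ω] {E F : Type*} (S : IPBES Ω E) (T : IPBES Ω F)
    (hS_nonzero : S.NonZero)
    (hS_feas : S.Feasible) (hS_term : S.Terminating)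
    (hT_feas : T.Feasible) (hT_term : T.Terminating)
    (hsim : S.SimulatedBy T) :
    IsProgram S.sem ∧ IsProgram T.sem ∧ S.SeqRefines T := by
  obtain ⟨f₀, hf₀⟩ := hsim
  obtain ⟨f, c, h⟩ := hf₀.exists_isListSimulation hS_nonzero
  refine ⟨hS_term.isProgram_sem, hT_term.isProgram_sem, fun s => ?_⟩
  refine closure_minimal (convexHull_min ?_ (hT_term.isProgram_sem.convex s)) isClosed_closure
  rintro _ ⟨σ, hσ, rfl⟩
  exact closure_mono (subset_convexHull ℝ _) (h.behaviour_mem_closure hσ hT_term s)
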